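/- **Types and calculus.** Let $Pr$ be a finite set of primitive types. Types are built from primitive types by the binary connectives $/$, $\backslash$ and $\cdot$; the degree of a type is its number of occurrences of connectives. $Tp(/)$ is the set of types in which no connective other than $/$ occurs, and $Tp_1(/)$ (resp. $Tp_1(/,\backslash)$) is the set of types of degree at most $1$ in which no connective other than $/$ (resp. other than $/$ and $\backslash$) occurs. Sequents have the form $\Gamma\to\alpha$ with $\Gamma$ a finite sequence of types and $\alpha$ a type. The calculus $\mathbf L(/\to)$ has the axiom $\alpha\to\alpha$, the Cut rule (from $\Gamma,\alpha,\Theta\to\beta$ and $\Delta\to\alpha$ infer $\Gamma,\Delta,\Theta\to\beta$) and the rule $(/\to)$: from $\Gamma\to\alpha$ and $\Delta,\beta,\Theta\to\gamma$ infer $\Delta,\beta/\alpha,\Gamma,\Theta\to\gamma$. The calculus $\mathbf L(/\to,\backslash\to)$ has in addition the rule $(\backslash\to)$: from $\Gamma\to\alpha$ and $\Delta,\beta,\Theta\to\gamma$ infer $\Delta,\Gamma,\alpha\backslash\beta,\Theta\to\gamma$. **Lambek grammars.** Let $V$ be a finite alphabet. A Lambek grammar over $V$ consists of a finite set $Pr$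 of primitive types, a distinguished type $S\in Pr$, and a map $f$ that assigns to each $a\in V$ a finite set $f(a)$ of types. Over a given calculus it recognises the set of all non-empty words $a_1\cdots a_n$ over $V$ for which there are $\alpha_k\in f(a_k)$ ($1\le k\le n$) such that $\alpha_1,\dots,\alpha_n\to S$ is provable. It has types in $X$ if $f(a)\subseteq X$ for all $a\in V$. **Theorem.** Let $V$ be a finite alphabet and let $L$ be a language over $V$. Grammars below have finitely many rules; $A,B$ denote nonterminals and $a\in V$ a terminal. (i) The following are equivalent: $L$ is recognised by a Lambek grammar over $\mathbf L(/\to)$ with types in $Tp(/)$; $L$ is generated by a context-free grammar in which every right-hand side is non-empty; $L$ is context-free and $\varepsilon\notin L$. (ii) The following are equivalent: $L$ is recognised by a Lambek grammar over $\mathbf L(/\to,\backslash\to)$ with types in $Tp_1(/,\backslash)$; $L$ is generated by a linear context-free grammar all of whose rules have the form $A\to aB$, $A\to Ba$ or $A\to a$; $L$ is a linear context-free language (generated by a context-free grammar in which every right-hand side contains at most one nonterminal) and $\varepsilon\notin L$. (iii) The following are equivalent: $L$ is recognised by a Lambek grammar over $\mathbf L(/\to)$ with types in $Tp_1(/)$;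 $L$ is generated by a right-regular grammar, all of whose rules have the form $A\to aB$ or $A\to a$; $L$ is regular and $\varepsilon\notin L$. -/

import Mathlib

namespace LambekFragments

universe u

/-- The three type-forming connectives. -/
inductive Connective : Type
  | slash
  | backslash
  | prod

/-- Types over a set `Pr` of primitive types. `slash β α` is `β / α`,
`backslash α β` is `α \ β` and `prod α β` is `α · β`. -/
inductive Tp (Pr : Type u) : Type u
  | prim (p : Pr) : Tp Pr
  | slash (β α : Tp Pr) : Tp Pr
  | backslash (α β : Tp Pr) : Tp Pr
  | prod (α β : Tp Pr) : Tp Pr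

namespace Tp

variable {Pr : Type u}

/-- The number of occurrences of connectives in a type. -/
def degree : Tp Pr → ℕ
  | prim _ => 0
  | slash β α => degree β + degree α + 1
  | backslash α β => degree α + degree β + 1
  | prod α β => degree α + degree β + 1

/-- The set of connectives that occur in a type. -/
def connectives : Tp Pr → Set Connective
  | prim _ => ∅
  | slash β α => {Connective.slash} ∪ (connectives β ∪ connectives α)
  | backslash α β => {Connective.backslash} ∪ (connectives α ∪ connectives β)
  | prod α β => {Connective.prod} ∪ (connectives α ∪ connectives β)

end Tp

/-- `TpOf Pr C` is the set `Tp(C)` of types in which only connectives from `C` occur. -/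
def TpOf (Pr : Type u) (C : Set Connective) : Set (Tp Pr) :=
  {α | α.connectives ⊆ C}

/-- `TpDeg Pr n C` is the set `Tp_n(C)` of types of degree at most `n`
in which only connectives from `C` occur. -/
def TpDeg (Pr : Type u) (n : ℕ) (C : Set Connective) : Set (Tp Pr) :=
  {α | α.degree ≤ n} ∩ TpOf Pr C

/-- Names of the six logical rules of the Lambek calculus: `slashL` is `(/ →)`,
`slashR` is `(→ /)`, and so on. -/
inductive RuleName : Type
  | slashL
  | slashR
  | backslashL
  | backslashR
  | prodL
  | prodR

/-- `Provable R Γ α`: the sequent `Γ → α` is provable in the fragment of the Lambek calculus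
that consists of Axiom, Cut and the logical rules in `R`. The calculus `L` itself is the case
`R = Set.univ`. -/
inductive Provable {Pr : Type u} (R : Set RuleName) : List (Tp Pr) → Tp Pr → Prop
  | ax (α : Tp Pr) : Provable R [α] α
  | cut {Γ Δ Θ : List (Tp Pr)} {α β : Tp Pr} :
      Provable R (Γ ++ [α] ++ Θ) β → Provable R Δ α → Provable R (Γ ++ Δ ++ Θ) β
  | backslashR {Γ : List (Tp Pr)} {α β : Tp Pr} (hR : RuleName.backslashR ∈ R) (hΓ : Γ ≠ []) :
      Provable R ([α] ++ Γ) β → Provable R Γ (Tp.backslash α β)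
  | backslashL {Γ Δ Θ : List (Tp Pr)} {α β γ : Tp Pr} (hR : RuleName.backslashL ∈ R) :
      Provable R Γ α → Provable R (Δ ++ [β] ++ Θ) γ →
        Provable R (Δ ++ Γ ++ [Tp.backslash α β] ++ Θ) γ
  | slashR {Γ : List (Tp Pr)} {α β : Tp Pr} (hR : RuleName.slashR ∈ R) (hΓ : Γ ≠ []) :
      Provable R (Γ ++ [α]) β → Provable R Γ (Tp.slash β α)
  | slashL {Γ Δ Θ : List (Tp Pr)} {α β γ : Tp Pr} (hR : RuleName.slashL ∈ R) :
      Provable R Γ α → Provable R (Δ ++ [β] ++ Θ) γ →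
        Provable R (Δ ++ [Tp.slash β α] ++ Γ ++ Θ) γ
  | prodR {Γ Δ : List (Tp Pr)} {α β : Tp Pr} (hR : RuleName.prodR ∈ R) :
      Provable R Γ α → Provable R Δ β → Provable R (Γ ++ Δ) (Tp.prod α β)
  | prodL {Γ Δ : List (Tp Pr)} {α β γ : Tp Pr} (hR : RuleName.prodL ∈ R) :
      Provable R (Γ ++ [α, β] ++ Δ) γ → Provable R (Γ ++ [Tp.prod α β] ++ Δ) γ

/-- A Lambek grammar over the alphabet `V`: a finite set of primitive types, a distinguished
primitive type, and an assignment of a finite set of types to each symbol. -/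
structure LambekGrammar (V : Type u) where
  /-- The primitive types. -/
  Pr : Type
  /-- There are finitely many primitive types. -/
  finite_Pr : Finite Pr
  /-- The distinguished type. -/
  start : Pr
  /-- The type assignment. -/
  assign : V → Set (Tp Pr)
  /-- Every symbol is assigned finitely many types. -/
  finite_assign : ∀ a, (assign a).Finite

namespace LambekGrammar

variable {V : Type u}

/-- The language recognised by a Lambek grammar over the fragment with rules `R`: the non-empty
words to which a type sequence is assigned that is reducible to the distinguished type. -/
def language (G : LambekGrammar V) (R : Set RuleName) : Language V :=
  {w | w ≠ [] ∧ ∃ Γ : List (Tp G.Pr),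
    List.Forall₂ (fun a α => α ∈ G.assign a) w Γ ∧ Provable R Γ (Tp.prim G.start)}

end LambekGrammar

section FormalGrammars

variable {V : Type u}

/-- No right-hand side of a production rule is empty. -/
def HasNoEmptyRule (g : ContextFreeGrammar V) : Prop :=
  ∀ r ∈ g.rules, r.output ≠ []

/-- The rule has the form `A → a`. -/
def IsTerminalRule {N : Type} (r : ContextFreeRule V N) : Prop :=
  ∃ a : V, r.output = [Symbol.terminal a]

/-- The rule has the form `A → aB`. -/
def IsRightLinearRule {N : Type} (r : ContextFreeRule V N) : Prop :=
  ∃ (a : V) (B : N), r.output = [Symbol.terminal a, Symbol.nonterminal B]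

/-- The rule has the form `A → Ba`. -/
def IsLeftLinearRule {N : Type} (r : ContextFreeRule V N) : Prop :=
  ∃ (a : V) (B : N), r.output = [Symbol.nonterminal B, Symbol.terminal a]

/-- Linear grammars whose rules have the form `A → aB`, `A → Ba` or `A → a`. -/
def IsLCFG (g : ContextFreeGrammar V) : Prop :=
  ∀ r ∈ g.rules, IsRightLinearRule r ∨ IsLeftLinearRule r ∨ IsTerminalRule r

/-- Right-regular grammars: the rules have the form `A → aB` or `A → a`. -/
def IsREG (g : ContextFreeGrammar V) : Prop :=
  ∀ r ∈ g.rules, IsRightLinearRule r ∨ IsTerminalRule r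

/-- Linear context-free languages in the usual general sense: generated by a context-free grammar
in which every right-hand side contains at most one nonterminal, that is, every rule has the form
`A → u` or `A → uBv` with (possibly empty) terminal words `u`, `v`. -/
def IsLinearContextFree (L : Language V) : Prop :=
  ∃ g : ContextFreeGrammar V,
    (∀ r ∈ g.rules,
      (∃ u : List V, r.output = u.map Symbol.terminal) ∨
      (∃ (u v : List V) (B : g.NT),
        r.output = u.map Symbol.terminal ++ [Symbol.nonterminal B] ++ v.map Symbol.terminal)) ∧
    g.language = L

end FormalGrammars

end LambekFragments

/-! Without right rules, provability is context-free rewriting on types. Read upwards, the left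
rules are productions `β → (β/α) α` and `β → α (α\β)`, and Cut is grafting of derivation trees. A
Lambek grammar is therefore a grammar in Chomsky normal form whose nonterminals are types and whose
terminal rules are the type assignment (`mem_language_iff_binGen`). With `/` alone only finitely
many types generate words, since a step passes from `β/α` to its subtype `β`.

Conversely, a Chomsky normal form is encoded by a left-corner transform: besides a primitive type
for each `A` there is one for the words that complete any word of `X` to a word of `A`. The first
letter of a phrase then acts as a functor on what follows, so `/` suffices. Completeness is
`binGen_leftCorner`; soundness comes from interpreting types by languages (`meaning`).

In degree at most 1 every functor is a single letter, and types `p/q`, `q\p`, `p` of `a` are the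
rules `p → aq`, `p → qa`, `p → a` (`binGen_iff_linGen`). Parts (ii) and (iii) are thus one argument,
with `left` telling whether `\` is present.

The normal forms of context-free and linear grammars are obtained semantically: nonterminals are the
finitely many pieces of right-hand sides, and every rule sound for derivability is admitted. -/

namespace LambekFragments

universe u v

/-! ### Chomsky and linear normal forms with possibly infinitely many nonterminals -/

section AbstractGrammars

variable {N : Type*} {V : Type*}

/-- Words generated by a grammar in Chomsky normal form whose rules are `A → BC` for `bin A B C`
and `A → a` for `term A a`. The nonterminals may be infinite in number. -/
inductive BinGen (bin : N → N → N → Prop) (term : N → V → Prop) : N → List V → Prop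
  | term {A : N} {a : V} : term A a → BinGen bin term A [a]
  | bin {A B C : N} {x y : List V} : bin A B C → BinGen bin term B x → BinGen bin term C y →
      BinGen bin term A (x ++ y)

/-- Words generated by a linear grammar whose rules are `A → aB` for `rt A a B`,
`A → Ba` for `lf A B a` and `A → a` for `tm A a`. -/
inductive LinGen (rt : N → V → N → Prop) (lf : N → N → V → Prop) (tm : N → V → Prop) :
    N → List V → Prop
  | tm {A : N} {a : V} : tm A a → LinGen rt lf tm A [a]
  | rt {A B : N} {a : V} {x : List V} : rt A a B → LinGen rt lf tm B x →
      LinGen rt lf tm A (a :: x)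
  | lf {A B : N} {a : V} {x : List V} : lf A B a → LinGen rt lf tm B x →
      LinGen rt lf tm A (x ++ [a])

variable {bin : N → N → N → Prop} {term : N → V → Prop}
  {rt : N → V → N → Prop} {lf : N → N → V → Prop} {tm : N → V → Prop}

theorem BinGen.ne_nil {A : N} {w : List V} (h : BinGen bin term A w) : w ≠ [] := by
  induction h <;> simp_all

theorem LinGen.ne_nil {A : N} {w : List V} (h : LinGen rt lf tm A w) : w ≠ [] := by
  cases h <;> simp

/-- Pulling back along a map that hits every productive nonterminal keeps the words. -/
theorem binGen_comap {M : Type*} (φ : M → N)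
    (hφ : ∀ A w, BinGen bin term A w → A ∈ Set.range φ) (i : M) (w : List V) :
    BinGen (fun i j k => bin (φ i) (φ j) (φ k)) (fun i a => term (φ i) a) i w ↔
      BinGen bin term (φ i) w := by
  constructor
  · intro h
    induction h with
    | term h => exact .term h
    | bin h _ _ ih₁ ih₂ => exact .bin h ih₁ ih₂
  · intro h
    generalize hA : φ i = A at h
    induction h generalizing i with
    | term h => subst hA; exact .term h
    | bin h h₁ h₂ ih₁ ih₂ =>
      subst hA
      obtain ⟨j, rfl⟩ := hφ _ _ h₁
      obtain ⟨k, rfl⟩ := hφ _ _ h₂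
      exact .bin h (ih₁ j rfl) (ih₂ k rfl)

theorem linGen_comap {M : Type*} (φ : M → N)
    (hφ : ∀ A w, LinGen rt lf tm A w → A ∈ Set.range φ) (i : M) (w : List V) :
    LinGen (fun i a j => rt (φ i) a (φ j)) (fun i j a => lf (φ i) (φ j) a)
      (fun i a => tm (φ i) a) i w ↔ LinGen rt lf tm (φ i) w := by
  constructor
  · intro h
    induction h with
    | tm h => exact .tm h
    | rt h _ ih => exact .rt h ih
    | lf h _ ih => exact .lf h ih
  · intro h
    generalize hA : φ i = A at h
    induction h generalizing i with
    | tm h => subst hA; exact .tm h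
    | rt h h₁ ih =>
      subst hA
      obtain ⟨j, rfl⟩ := hφ _ _ h₁
      exact .rt h (ih j rfl)
    | lf h h₁ ih =>
      subst hA
      obtain ⟨j, rfl⟩ := hφ _ _ h₁
      exact .lf h (ih j rfl)

/-- The language is generated by a finite grammar in Chomsky normal form. -/
def IsBinGenerated (L : Language V) : Prop :=
  ∃ (N : Type) (_ : Finite N) (S : N) (bin : N → N → N → Prop) (term : N → V → Prop),
    ∀ w, w ∈ L ↔ BinGen bin term S w

/-- The language is generated by a finite linear grammar with rules `A → aB`, `A → a` and,
if `left` holds, `A → Ba`. -/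
def IsLinGenerated (left : Prop) (L : Language V) : Prop :=
  ∃ (N : Type) (_ : Finite N) (S : N) (rt : N → V → N → Prop) (lf : N → N → V → Prop)
    (tm : N → V → Prop), (∀ A B a, lf A B a → left) ∧ ∀ w, w ∈ L ↔ LinGen rt lf tm S w

theorem exists_fin_range_eq {F : Set N} (hF : F.Finite) :
    ∃ (n : ℕ) (φ : Fin n → N), Set.range φ = F := by
  obtain ⟨n, ⟨e⟩⟩ := hF.to_subtype.exists_equiv_fin
  exact ⟨n, Subtype.val ∘ e.symm, by rw [e.symm.surjective.range_comp, Subtype.range_coe]⟩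

/-- Nonterminals that generate nothing can be discarded, except that `S` must survive even if
unproductive. Reindexing by `Fin n` also brings the nonterminals down to `Type`. -/
theorem IsBinGenerated.of_finite {L : Language V} {S : N} {F : Set N} (hF : F.Finite)
    (hprod : ∀ A w, BinGen bin term A w → A ∈ F) (hL : ∀ w, w ∈ L ↔ BinGen bin term S w) :
    IsBinGenerated L := by
  obtain ⟨n, φ, hφ⟩ := exists_fin_range_eq (hF.insert S)
  obtain ⟨s, rfl⟩ : S ∈ Set.range φ := by simp [hφ]
  refine ⟨Fin n, inferInstance, s, _, _, fun w => (hL w).trans (binGen_comap φ ?_ s w).symm⟩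
  intro A w h
  rw [hφ]
  exact .inr (hprod A w h)

theorem IsLinGenerated.of_finite {left : Prop} {L : Language V} {S : N} {F : Set N}
    (hF : F.Finite) (hprod : ∀ A w, LinGen rt lf tm A w → A ∈ F)
    (hleft : ∀ A B a, lf A B a → left) (hL : ∀ w, w ∈ L ↔ LinGen rt lf tm S w) :
    IsLinGenerated left L := by
  obtain ⟨n, φ, hφ⟩ := exists_fin_range_eq (hF.insert S)
  obtain ⟨s, rfl⟩ : S ∈ Set.range φ := by simp [hφ]
  refine ⟨Fin n, inferInstance, s, _, _, _, fun _ _ _ h => hleft _ _ _ h,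
    fun w => (hL w).trans (linGen_comap φ ?_ s w).symm⟩
  intro A w h
  rw [hφ]
  exact .inr (hprod A w h)

theorem IsBinGenerated.nil_notMem {L : Language V} (h : IsBinGenerated L) : [] ∉ L := by
  obtain ⟨N, _, S, bin, term, hL⟩ := h
  exact fun h => ((hL _).1 h).ne_nil rfl

theorem IsLinGenerated.nil_notMem {left : Prop} {L : Language V} (h : IsLinGenerated left L) :
    [] ∉ L := by
  obtain ⟨N, _, S, rt, lf, tm, -, hL⟩ := h
  exact fun h => ((hL _).1 h).ne_nil rfl

end AbstractGrammars

/-! ### Regular languages and right-linear rules -/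

section RegularLanguages

variable {V : Type u}

/-- States serve as nonterminals, and the last letter is emitted by `p → a` whenever `a` leads from
`p` to acceptance. -/
theorem isLinGenerated_false_of_isRegular {L : Language V} (h : L.IsRegular) (hL : [] ∉ L) :
    IsLinGenerated False L := by
  obtain ⟨σ, _, M, rfl⟩ := h
  refine ⟨σ, inferInstance, M.start, fun p a q => M.step p a = q, fun _ _ _ => False,
    fun p a => M.step p a ∈ M.accept, fun _ _ _ => id, ?_⟩
  have key : ∀ (w : List V) (p : σ), LinGen (fun p a q => M.step p a = q) (fun _ _ _ => False)
      (fun p a => M.step p a ∈ M.accept) p w ↔ w ≠ [] ∧ M.evalFrom p w ∈ M.accept := by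
    intro w p
    constructor
    · intro h
      refine ⟨h.ne_nil, ?_⟩
      induction h with
      | tm h => simpa using h
      | rt h _ ih => subst h; simpa using ih
      | lf h => exact h.elim
    · rintro ⟨hw, h⟩
      induction w generalizing p with
      | nil => exact absurd rfl hw
      | cons a w ih =>
        rcases eq_or_ne w [] with rfl | hw'
        · exact .tm (by simpa using h)
        · exact .rt rfl (ih _ hw' (by simpa using h))
  intro w
  rw [key]
  exact ⟨fun h => ⟨fun hw => hL (hw ▸ h), h⟩, fun h => h.2⟩

theorem IsLinGenerated.isRegular {L : Language V} (h : IsLinGenerated False L) :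
    L.IsRegular := by
  obtain ⟨N, _, S, rt, lf, tm, hlf, hL⟩ := h
  -- The extra state `none` is the sole accepting one. It is entered by terminal rules and has no
  -- outgoing transitions, so it must be reached on the last letter.
  let M : NFA V (Option N) :=
    { step := fun p a => {q | ∃ A, p = some A ∧
        ((∃ B, q = some B ∧ rt A a B) ∨ (q = none ∧ tm A a))}
      start := {some S}
      accept := {none} }
  have key : ∀ (w : List V) (X : Set (Option N)), none ∈ M.evalFrom X w ↔
      (w = [] ∧ none ∈ X) ∨ ∃ A, some A ∈ X ∧ LinGen rt lf tm A w := by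
    intro w
    induction w with
    | nil =>
      intro X
      simp only [NFA.evalFrom_nil, true_and]
      exact ⟨.inl, fun h => h.elim id fun ⟨A, _, h⟩ => absurd rfl h.ne_nil⟩
    | cons a w ih =>
      intro X
      rw [NFA.evalFrom_cons, ih]
      simp only [NFA.mem_stepSet, reduceCtorEq, false_and, false_or]
      constructor
      · rintro (⟨rfl, t, ht, A, rfl, h⟩ | ⟨B, ⟨t, ht, A, rfl, h⟩, hB⟩)
        · obtain ⟨B, h, -⟩ | ⟨-, h⟩ := h
          · cases h
          · exact ⟨A, ht, .tm h⟩
        · obtain ⟨C, h, hr⟩ | ⟨h, -⟩ := h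
          · cases h
            exact ⟨A, ht, .rt hr hB⟩
          · cases h
      · rintro ⟨A, hA, h⟩
        generalize hw : a :: w = x at h
        cases h with
        | tm h =>
          cases hw
          exact .inl ⟨rfl, _, hA, A, rfl, .inr ⟨rfl, h⟩⟩
        | rt h h' =>
          cases hw
          exact .inr ⟨_, ⟨_, hA, A, rfl, .inl ⟨_, rfl, h⟩⟩, h'⟩
        | lf h => exact (hlf _ _ _ h).elim
  refine ⟨Set (Option N), Fintype.ofFinite _, M.toDFA, ?_⟩
  ext w
  rw [NFA.toDFA_correct, NFA.mem_accepts, hL]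
  simp [M, key]

end RegularLanguages

/-! ### Context-free grammars: big-step semantics and normal forms -/

section ContextFreeGrammars

variable {V : Type u}

/-- Big-step derivation of a terminal word from a sentential form of a context-free grammar. -/
inductive Yields (g : ContextFreeGrammar V) : List (Symbol V g.NT) → List V → Prop
  | nil : Yields g [] []
  | terminal {a : V} {s : List (Symbol V g.NT)} {x : List V} :
      Yields g s x → Yields g (.terminal a :: s) (a :: x)
  | nonterminal {r : ContextFreeRule V g.NT} {s : List (Symbol V g.NT)} {x y : List V} :
      r ∈ g.rules → Yields g r.output x → Yields g s y →
        Yields g (.nonterminal r.input :: s) (x ++ y)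

variable {g : ContextFreeGrammar V}

theorem Yields.map_terminal (w : List V) : Yields g (w.map .terminal) w := by
  induction w with
  | nil => exact .nil
  | cons a w ih => exact .terminal ih

theorem Yields.append {s t : List (Symbol V g.NT)} {x y : List V} (hs : Yields g s x)
    (ht : Yields g t y) : Yields g (s ++ t) (x ++ y) := by
  induction hs with
  | nil => exact ht
  | terminal _ ih => exact .terminal ih
  | nonterminal hr h _ _ ih =>
    rw [List.append_assoc]
    exact .nonterminal hr h ih

theorem Yields.exists_of_append {s t : List (Symbol V g.NT)} {w : List V}
    (h : Yields g (s ++ t) w) : ∃ x y, w = x ++ y ∧ Yields g s x ∧ Yields g t y := by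
  induction s generalizing w with
  | nil => exact ⟨[], w, rfl, .nil, h⟩
  | cons c s ih =>
    cases h with
    | terminal h =>
      obtain ⟨x, y, rfl, hx, hy⟩ := ih h
      exact ⟨_ :: x, y, rfl, .terminal hx, hy⟩
    | nonterminal hr h' h =>
      obtain ⟨x, y, rfl, hx, hy⟩ := ih h
      exact ⟨_ ++ x, y, by simp, .nonterminal hr h' hx, hy⟩

theorem Yields.eq_of_map_terminal {w x : List V} (h : Yields g (w.map .terminal) x) : x = w := by
  induction w generalizing x with
  | nil => cases h; rfl
  | cons a w ih =>
    cases h with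
    | terminal h => rw [ih h]

theorem Yields.of_rule {r : ContextFreeRule V g.NT} {w : List V} (hr : r ∈ g.rules)
    (h : Yields g r.output w) : Yields g [.nonterminal r.input] w := by
  simpa using Yields.nonterminal hr h .nil

theorem yields_iff_derives {s : List (Symbol V g.NT)} {w : List V} :
    Yields g s w ↔ g.Derives s (w.map .terminal) := by
  constructor
  · intro h
    induction h with
    | nil => rfl
    | terminal _ ih => simpa using ih.append_left [_]
    | @nonterminal r s x y hr _ _ ih₁ ih₂ =>
      have h₁ : g.Produces (.nonterminal r.input :: s) (r.output ++ s) := ⟨r, hr, .head s⟩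
      rw [List.map_append]
      exact h₁.trans_derives ((ih₁.append_right s).trans (ih₂.append_left _))
  · intro h
    induction h using Relation.ReflTransGen.head_induction_on with
    | refl => exact .map_terminal w
    -- The yield of the rewritten form is cut around the inserted right-hand side, whose share
    -- becomes the yield of the replaced nonterminal.
    | head h _ ih =>
      obtain ⟨r, hr, h⟩ := h
      obtain ⟨p, q, rfl, rfl⟩ := h.exists_parts
      obtain ⟨x, y, rfl, hx, hy⟩ := ih.exists_of_append
      obtain ⟨x, z, rfl, hx, hz⟩ := hx.exists_of_append
      exact (hx.append (.of_rule hr hz)).append hy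

theorem mem_language_iff_yields {w : List V} :
    w ∈ g.language ↔ Yields g [.nonterminal g.initial] w :=
  yields_iff_derives.symm

/-- The language of a sentential form when nonterminals are interpreted by `P`. -/
def interp {N : Type*} (P : N → Language V) : List (Symbol V N) → Language V
  | [] => 1
  | .terminal a :: s => {[a]} * interp P s
  | .nonterminal A :: s => P A * interp P s

theorem mem_interp_nonterminal {N : Type*} {P : N → Language V} {A : N} {w : List V} :
    w ∈ interp P [.nonterminal A] ↔ w ∈ P A := by
  rw [interp, interp, mul_one]

theorem mem_interp_terminal {N : Type*} {P : N → Language V} {a : V} {w : List V} :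
    w ∈ interp P [.terminal a] ↔ w = [a] := by
  rw [interp, interp, mul_one]
  rfl

/-- An interpretation that is closed under the rules contains the generated words. -/
theorem Yields.mem_interp {P : g.NT → Language V}
    (hP : ∀ r ∈ g.rules, ∀ w ∈ interp P r.output, w ∈ P r.input)
    {s : List (Symbol V g.NT)} {w : List V} (h : Yields g s w) : w ∈ interp P s := by
  induction h with
  | nil => exact rfl
  | @terminal a s x _ ih => exact Language.append_mem_mul (a := [a]) rfl ih
  | nonterminal hr _ _ ih₁ ih₂ => exact Language.append_mem_mul (hP _ hr _ ih₁) ih₂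

theorem HasNoEmptyRule.nil_notMem (hg : HasNoEmptyRule g) : [] ∉ g.language := by
  have key : ∀ s w, Yields g s w → s ≠ [] → w ≠ [] := by
    intro s w h
    induction h with
    | nil => exact fun h => absurd rfl h
    | terminal => simp
    | nonterminal hr _ _ ih => simp [ih (hg _ hr)]
  exact fun h => key _ _ (mem_language_iff_yields.1 h) (by simp) rfl

theorem finite_setOf_output_length_le {N : Type*} [Finite V] [Finite N] (n : ℕ) :
    {r : ContextFreeRule V N | r.output.length ≤ n}.Finite := by
  have : Finite (Symbol V N) := by
    have := Fintype.ofFinite V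
    have := Fintype.ofFinite N
    infer_instance
  refine Set.Finite.of_injOn (f := fun r => (r.input, r.output))
    (t := Set.univ ×ˢ {l : List (Symbol V N) | l.length ≤ n}) (fun r hr => ⟨trivial, hr⟩) ?_
    (Set.finite_univ.prod (List.finite_length_le _ n))
  intro r _ r' _ h
  simp only [Prod.mk.injEq] at h
  exact ContextFreeRule.ext h.1 h.2

theorem exists_finset_rules {N : Type} [Finite V] [Finite N]
    (R : Set (ContextFreeRule V N)) (n : ℕ) (hR : ∀ r ∈ R, r.output.length ≤ n) :
    ∃ rules : Finset (ContextFreeRule V N), ∀ r, r ∈ rules ↔ r ∈ R :=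
  ⟨((finite_setOf_output_length_le n).subset hR).toFinset, by simp⟩

theorem IsBinGenerated.exists_hasNoEmptyRule [Finite V] {L : Language V}
    (h : IsBinGenerated L) : ∃ g : ContextFreeGrammar V, HasNoEmptyRule g ∧ g.language = L := by
  obtain ⟨N, _, S, bin, term, hL⟩ := h
  obtain ⟨rules, hrules⟩ := exists_finset_rules
    {r : ContextFreeRule V N | (∃ B C, bin r.input B C ∧
      r.output = [.nonterminal B, .nonterminal C]) ∨
      ∃ a, term r.input a ∧ r.output = [.terminal a]} 2
    (by rintro r (⟨B, C, -, h⟩ | ⟨a, -, h⟩) <;> simp [h])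
  refine ⟨⟨N, S, rules⟩, ?_, ?_⟩
  · intro r hr
    obtain ⟨B, C, -, h⟩ | ⟨a, -, h⟩ := (hrules r).1 hr <;> simp [h]
  ext w
  rw [mem_language_iff_yields, hL]
  constructor
  · intro h
    -- The generated languages form the least interpretation closed under the rules, so it is enough
    -- to check closure of `BinGen`.
    have := h.mem_interp (P := fun A => {w | BinGen bin term A w}) ?_
    · exact mem_interp_nonterminal.1 this
    rintro ⟨A, s⟩ hr w hw
    obtain ⟨B, C, h, rfl⟩ | ⟨a, h, rfl⟩ := (hrules _).1 hr
    · obtain ⟨x, hx, y, hy, rfl⟩ := Language.mem_mul.1 hw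
      exact .bin h hx (mem_interp_nonterminal.1 hy)
    · obtain rfl : w = [a] := mem_interp_terminal.1 hw
      exact .term h
  · suffices key : ∀ A, BinGen bin term A w → Yields (g := ⟨N, S, rules⟩) [.nonterminal A] w
      from key S
    intro A h
    clear hL
    induction h with
    | @term A a h =>
      exact Yields.of_rule (g := ⟨N, S, rules⟩) (r := ⟨A, [.terminal a]⟩) ((hrules _).2 (.inr ⟨a, h, rfl⟩))
        (.map_terminal [a])
    | @bin A B C x y h _ _ ih₁ ih₂ =>
      exact Yields.of_rule (g := ⟨N, S, rules⟩) (r := ⟨A, [.nonterminal B, .nonterminal C]⟩)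
        ((hrules _).2 (.inl ⟨B, C, h, rfl⟩)) (ih₁.append ih₂)

/-- Rules `A → aB`, `A → a` and, if `left` holds, `A → Ba`. -/
def IsSimpleLinear (left : Prop) (g : ContextFreeGrammar V) : Prop :=
  ∀ r ∈ g.rules, IsRightLinearRule r ∨ (left ∧ IsLeftLinearRule r) ∨ IsTerminalRule r

theorem IsLinGenerated.exists_isSimpleLinear [Finite V] {left : Prop} {L : Language V}
    (h : IsLinGenerated left L) :
    ∃ g : ContextFreeGrammar V, IsSimpleLinear left g ∧ g.language = L := by
  obtain ⟨N, _, S, rt, lf, tm, hlf, hL⟩ := h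
  obtain ⟨rules, hrules⟩ := exists_finset_rules
    {r : ContextFreeRule V N |
      (∃ a B, rt r.input a B ∧ r.output = [.terminal a, .nonterminal B]) ∨
      (∃ a B, lf r.input B a ∧ r.output = [.nonterminal B, .terminal a]) ∨
      ∃ a, tm r.input a ∧ r.output = [.terminal a]} 2
    (by rintro r (⟨B, C, -, h⟩ | ⟨B, C, -, h⟩ | ⟨a, -, h⟩) <;> simp [h])
  refine ⟨⟨N, S, rules⟩, ?_, ?_⟩
  · intro r hr
    obtain ⟨a, B, -, h⟩ | ⟨a, B, hl, h⟩ | ⟨a, -, h⟩ := (hrules r).1 hr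
    · exact .inl ⟨a, B, h⟩
    · exact .inr (.inl ⟨hlf _ _ _ hl, a, B, h⟩)
    · exact .inr (.inr ⟨a, h⟩)
  ext w
  rw [mem_language_iff_yields, hL]
  constructor
  · intro h
    have := h.mem_interp (P := fun A => {w | LinGen rt lf tm A w}) ?_
    · exact mem_interp_nonterminal.1 this
    rintro ⟨A, s⟩ hr w hw
    obtain ⟨a, B, h, rfl⟩ | ⟨a, B, h, rfl⟩ | ⟨a, h, rfl⟩ := (hrules _).1 hr
    · obtain ⟨x, rfl, y, hy, rfl⟩ := Language.mem_mul.1 hw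
      exact .rt h (mem_interp_nonterminal.1 hy)
    · obtain ⟨x, hx, y, hy, rfl⟩ := Language.mem_mul.1 hw
      obtain rfl : y = [a] := mem_interp_terminal.1 hy
      exact .lf h hx
    · obtain rfl : w = [a] := mem_interp_terminal.1 hw
      exact .tm h
  · suffices key : ∀ A, LinGen rt lf tm A w → Yields (g := ⟨N, S, rules⟩) [.nonterminal A] w
      from key S
    intro A h
    clear hL
    induction h with
    | @tm A a h =>
      exact Yields.of_rule (g := ⟨N, S, rules⟩) (r := ⟨A, [.terminal a]⟩) ((hrules _).2 (.inr (.inr ⟨a, h, rfl⟩)))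
        (.map_terminal [a])
    | @rt A B a x h _ ih =>
      exact Yields.of_rule (g := ⟨N, S, rules⟩) (r := ⟨A, [.terminal a, .nonterminal B]⟩)
        ((hrules _).2 (.inl ⟨a, B, h, rfl⟩)) (.terminal ih)
    | @lf A B a x h _ ih =>
      exact Yields.of_rule (g := ⟨N, S, rules⟩) (r := ⟨A, [.nonterminal B, .terminal a]⟩)
        ((hrules _).2 (.inr (.inl ⟨a, B, h, rfl⟩))) (ih.append (.map_terminal [a]))

/-- The scattered subwords of right-hand sides, of the initial form and of terminals. -/
def subforms (g : ContextFreeGrammar V) : Set (List (Symbol V g.NT)) :=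
  {s | ∃ t ∈ {[.nonterminal g.initial]} ∪ ContextFreeRule.output '' (g.rules : Set _) ∪
    Set.range (fun a => [.terminal a]), s.Sublist t}

theorem finite_subforms [Finite V] : (subforms g).Finite := by
  have h : ({[.nonterminal g.initial]} ∪ ContextFreeRule.output '' (g.rules : Set _) ∪
    Set.range (fun a => [.terminal a]) : Set (List (Symbol V g.NT))).Finite :=
    ((Set.finite_singleton _).union (g.rules.finite_toSet.image _)).union (Set.finite_range _)
  refine (h.biUnion fun t _ => (List.finite_toSet t.sublists)).subset ?_
  rintro s ⟨t, ht, hs⟩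
  exact Set.mem_biUnion ht (List.mem_sublists.2 hs)

/-- Tails arise when a leading symbol is split off, initial segments when a trailing terminal is;
closure under sublists covers both. -/
theorem mem_subforms_of_sublist {s t : List (Symbol V g.NT)} (ht : t ∈ subforms g)
    (h : s.Sublist t) : s ∈ subforms g := by
  obtain ⟨t', ht', h'⟩ := ht
  exact ⟨t', ht', h.trans h'⟩

theorem initial_mem_subforms : [.nonterminal g.initial] ∈ subforms g :=
  ⟨_, .inl (.inl rfl), .refl _⟩

theorem output_mem_subforms {r : ContextFreeRule V g.NT} (hr : r ∈ g.rules) :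
    r.output ∈ subforms g :=
  ⟨_, .inl (.inr ⟨r, hr, rfl⟩), .refl _⟩

theorem terminal_mem_subforms (a : V) : [.terminal a] ∈ subforms g :=
  ⟨_, .inr ⟨a, rfl⟩, .refl _⟩

/-- A rule `s → t t'` is admitted whenever it is valid for `Yields`, so soundness is immediate.
Completeness splits a form into head and tail; if one of them yields the empty word, `mono` takes
over. -/
theorem isBinGenerated_of_isContextFree [Finite V] {L : Language V} (h : L.IsContextFree)
    (hL : [] ∉ L) : IsBinGenerated L := by
  obtain ⟨g, rfl⟩ := h
  let bin (s t t' : List (Symbol V g.NT)) : Prop :=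
    s ∈ subforms g ∧ ∀ x y, Yields g t x → Yields g t' y → Yields g s (x ++ y)
  let term (s : List (Symbol V g.NT)) (a : V) : Prop := s ∈ subforms g ∧ Yields g s [a]
  have sound : ∀ s w, BinGen bin term s w → Yields g s w := by
    intro s w h
    induction h with
    | term h => exact h.2
    | bin h _ _ ih₁ ih₂ => exact h.2 _ _ ih₁ ih₂
  -- Relabelling the root from `t` to `s` leaves a valid rule. This replaces the elimination of
  -- empty and unit productions.
  have mono : ∀ s t, s ∈ subforms g → (∀ w, Yields g t w → Yields g s w) →
      ∀ w, BinGen bin term t w → BinGen bin term s w := by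
    intro s t hs hst w h
    cases h with
    | term h => exact .term ⟨hs, hst _ h.2⟩
    | bin h h₁ h₂ => exact .bin ⟨hs, fun x y hx hy => hst _ (h.2 x y hx hy)⟩ h₁ h₂
  have complete : ∀ s w, Yields g s w → s ∈ subforms g → w ≠ [] → BinGen bin term s w := by
    intro s w h
    induction h with
    | nil => exact fun _ h => absurd rfl h
    | @terminal a s x h ih =>
      intro hs _
      rcases eq_or_ne x [] with rfl | hx
      · exact .term ⟨hs, h.terminal⟩
      · exact .bin (B := [.terminal a]) (C := s) (x := [a])
          ⟨hs, fun y z hy hz => show Yields g ([.terminal a] ++ s) _ from hy.append hz⟩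
          (.term ⟨terminal_mem_subforms a, .map_terminal [a]⟩)
          (ih (mem_subforms_of_sublist hs (List.sublist_cons_self _ _)) hx)
    | @nonterminal r s x y hr h₁ h₂ ih₁ ih₂ =>
      intro hs hw
      have hs' := mem_subforms_of_sublist hs (List.sublist_cons_self _ _)
      have hr' := output_mem_subforms hr
      rcases eq_or_ne x [] with rfl | hx
      · exact mono _ _ hs (fun w hw => .nonterminal hr h₁ hw) _ (ih₂ hs' hw)
      rcases eq_or_ne y [] with rfl | hy
      · rw [List.append_nil]
        exact mono _ _ hs (fun w hw => by simpa using Yields.nonterminal hr hw h₂) _ (ih₁ hr' hx)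
      · exact .bin ⟨hs, fun _ _ h h' => .nonterminal hr h h'⟩ (ih₁ hr' hx) (ih₂ hs' hy)
  refine .of_finite (bin := bin) (term := term) (S := [.nonterminal g.initial])
    finite_subforms ?_ fun w => ?_
  · intro A w h
    cases h with
    | term h => exact h.1
    | bin h => exact h.1
  · rw [mem_language_iff_yields]
    exact ⟨fun h => complete _ _ h initial_mem_subforms
      fun hw => hL (mem_language_iff_yields.2 (hw ▸ h)), sound _ _⟩

/-- Every right-hand side contains at most one nonterminal. -/
def IsLinearGrammar (g : ContextFreeGrammar V) : Prop :=
  ∀ r ∈ g.rules,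
    (∃ u : List V, r.output = u.map Symbol.terminal) ∨
    (∃ (u v : List V) (B : g.NT),
      r.output = u.map Symbol.terminal ++ [Symbol.nonterminal B] ++ v.map Symbol.terminal)

theorem IsSimpleLinear.isLinearGrammar {left : Prop} (h : IsSimpleLinear left g) :
    IsLinearGrammar g := by
  intro r hr
  obtain ⟨a, B, h⟩ | ⟨-, a, B, h⟩ | ⟨a, h⟩ := h r hr
  · exact .inr ⟨[a], [], B, h⟩
  · exact .inr ⟨[], [a], B, h⟩
  · exact .inl ⟨[a], h⟩

/-- Whether a symbol is a nonterminal. -/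
def isNonterminal {N : Type*} : Symbol V N → Bool
  | .terminal _ => false
  | .nonterminal _ => true

theorem countP_map_terminal {N : Type*} (w : List V) :
    (w.map (Symbol.terminal (N := N))).countP isNonterminal = 0 := by
  simp [List.countP_eq_zero, isNonterminal]

theorem exists_eq_map_terminal {N : Type*} {s : List (Symbol V N)}
    (h : s.countP isNonterminal = 0) : ∃ w : List V, s = w.map Symbol.terminal := by
  induction s with
  | nil => exact ⟨[], rfl⟩
  | cons c s ih =>
    cases c with
    | terminal a =>
      obtain ⟨w, rfl⟩ := ih (by simpa [isNonterminal] using h)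
      exact ⟨a :: w, rfl⟩
    | nonterminal A => simp [isNonterminal] at h

theorem IsLinearGrammar.countP_le_one (hg : IsLinearGrammar g) {s : List (Symbol V g.NT)}
    (hs : s ∈ subforms g) : s.countP isNonterminal ≤ 1 := by
  obtain ⟨t, (rfl | ⟨r, hr, rfl⟩) | ⟨a, rfl⟩, hs⟩ := hs
  · exact hs.countP_le.trans (by simp [isNonterminal])
  · refine hs.countP_le.trans ?_
    obtain ⟨u, h⟩ | ⟨u, v, B, h⟩ := hg r hr <;> rw [h]
    · exact (countP_map_terminal u).trans_le zero_le_one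
    · simp only [List.countP_append, countP_map_terminal]
      simp [isNonterminal]
  · exact hs.countP_le.trans (by simp [isNonterminal])

theorem IsLinearGrammar.isLinGenerated [Finite V] (hg : IsLinearGrammar g)
    (hL : [] ∉ g.language) : IsLinGenerated True g.language := by
  let rt (s : List (Symbol V g.NT)) (a : V) (t : List (Symbol V g.NT)) : Prop :=
    s ∈ subforms g ∧ ∀ x, Yields g t x → Yields g s (a :: x)
  let lf (s t : List (Symbol V g.NT)) (a : V) : Prop :=
    s ∈ subforms g ∧ ∀ x, Yields g t x → Yields g s (x ++ [a])
  let tm (s : List (Symbol V g.NT)) (a : V) : Prop := s ∈ subforms g ∧ Yields g s [a]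
  have sound : ∀ s w, LinGen rt lf tm s w → Yields g s w := by
    intro s w h
    induction h with
    | tm h => exact h.2
    | rt h _ ih => exact h.2 _ ih
    | lf h _ ih => exact h.2 _ ih
  have mono : ∀ s t, s ∈ subforms g → (∀ w, Yields g t w → Yields g s w) →
      ∀ w, LinGen rt lf tm t w → LinGen rt lf tm s w := by
    intro s t hs hst w h
    cases h with
    | tm h => exact .tm ⟨hs, hst _ h.2⟩
    | rt h h' => exact .rt ⟨hs, fun x hx => hst _ (h.2 x hx)⟩ h'
    | lf h h' => exact .lf ⟨hs, fun x hx => hst _ (h.2 x hx)⟩ h'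
  have complete : ∀ s w, Yields g s w → s ∈ subforms g → w ≠ [] → LinGen rt lf tm s w := by
    intro s w h
    induction h with
    | nil => exact fun _ h => absurd rfl h
    | @terminal a s x h ih =>
      intro hs _
      rcases eq_or_ne x [] with rfl | hx
      · exact .tm ⟨hs, h.terminal⟩
      · exact .rt (B := s) ⟨hs, fun _ => .terminal⟩
          (ih (mem_subforms_of_sublist hs (List.sublist_cons_self _ _)) hx)
    | @nonterminal r s x y hr h₁ h₂ ih₁ ih₂ =>
      intro hs hw
      -- The head uses up the single nonterminal allowed, so the tail is terminal and can be peeled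
      -- off from the right by rules `A → Ba`.
      obtain ⟨v, rfl⟩ : ∃ v : List V, s = v.map .terminal :=
        exists_eq_map_terminal (by
          have := hg.countP_le_one hs
          simp only [List.countP_cons, isNonterminal, if_true] at this
          omega)
      obtain rfl := h₂.eq_of_map_terminal
      clear h₂ ih₂
      induction y using List.reverseRecOn with
      | nil =>
        rw [List.append_nil] at hw ⊢
        exact mono _ _ hs (fun _ => .of_rule hr) _ (ih₁ (output_mem_subforms hr) hw)
      | append_singleton v a ihv =>
        rw [← List.append_assoc]
        rw [List.map_append, List.map_singleton, ← List.cons_append] at hs ⊢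
        by_cases hxv : x ++ v = []
        · obtain ⟨rfl, rfl⟩ := List.append_eq_nil_iff.1 hxv
          exact .tm ⟨hs, .nonterminal hr h₁ (.map_terminal [a])⟩
        · exact .lf ⟨hs, fun _ h => h.append (.map_terminal [a])⟩
            (ihv hxv (mem_subforms_of_sublist hs (List.sublist_append_left _ _)))
  refine .of_finite (rt := rt) (lf := lf) (tm := tm) (S := [.nonterminal g.initial])
    finite_subforms ?_ (fun _ _ _ _ => trivial) fun w => ?_
  · intro A w h
    cases h with
    | tm h => exact h.1
    | rt h => exact h.1
    | lf h => exact h.1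
  · rw [mem_language_iff_yields]
    exact ⟨fun h => complete _ _ h initial_mem_subforms
      fun hw => hL (mem_language_iff_yields.2 (hw ▸ h)), sound _ _⟩

/-- The type `g.NT` may be infinite, but only left-hand sides of the finitely many rules generate
words. -/
theorem IsSimpleLinear.isLinGenerated {left : Prop} (hg : IsSimpleLinear left g) :
    IsLinGenerated left g.language := by
  let rt (A : g.NT) (a : V) (B : g.NT) : Prop := ⟨A, [.terminal a, .nonterminal B]⟩ ∈ g.rules
  let lf (A B : g.NT) (a : V) : Prop := left ∧ ⟨A, [.nonterminal B, .terminal a]⟩ ∈ g.rules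
  let tm (A : g.NT) (a : V) : Prop := ⟨A, [.terminal a]⟩ ∈ g.rules
  refine .of_finite (rt := rt) (lf := lf) (tm := tm) (S := g.initial)
    (g.rules.finite_toSet.image ContextFreeRule.input) ?_ (fun _ _ _ h => h.1) fun w => ?_
  · intro A w h
    cases h with
    | tm h => exact ⟨_, h, rfl⟩
    | rt h => exact ⟨_, h, rfl⟩
    | lf h => exact ⟨_, h.2, rfl⟩
  rw [mem_language_iff_yields]
  constructor
  · intro h
    have := h.mem_interp (P := fun A => {w | LinGen rt lf tm A w}) ?_
    · exact mem_interp_nonterminal.1 this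
    rintro ⟨A, s⟩ hr w hw
    obtain ⟨a, B, rfl : s = _⟩ | ⟨hl, a, B, rfl : s = _⟩ | ⟨a, rfl : s = _⟩ := hg _ hr
    · obtain ⟨x, rfl, y, hy, rfl⟩ := Language.mem_mul.1 hw
      exact .rt hr (mem_interp_nonterminal.1 hy)
    · obtain ⟨x, hx, y, hy, rfl⟩ := Language.mem_mul.1 hw
      obtain rfl : y = [a] := mem_interp_terminal.1 hy
      exact .lf ⟨hl, hr⟩ hx
    · obtain rfl : w = [a] := mem_interp_terminal.1 hw
      exact .tm hr
  · generalize g.initial = A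
    intro h
    induction h with
    | tm h => exact .of_rule h (.map_terminal [_])
    | rt h _ ih => exact .of_rule h (.terminal ih)
    | lf h _ ih => exact .of_rule h.2 (ih.append (.map_terminal [_]))

end ContextFreeGrammars

/-! ### Left-rule calculi as grammars on types -/

section Calculus

variable {Pr : Type u} {R : Set RuleName}

/-- One reduction step of the calculus with the left rules in `R`, read upwards: `X, Y → β`. -/
def reduction (R : Set RuleName) (β X Y : Tp Pr) : Prop :=
  (RuleName.slashL ∈ R ∧ X = .slash β Y) ∨ (RuleName.backslashL ∈ R ∧ Y = .backslash X β)

/-- With equality as terminal relation, a tree has nonterminals on its leaves, and a tree for `α`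
can be grafted onto a leaf `α`. This is what makes Cut admissible. -/
theorem BinGen.subst {N : Type*} {bin : N → N → N → Prop} {β : N} {Ξ : List N}
    (h : BinGen bin (· = ·) β Ξ) {Γ Δ Θ : List N} {α : N} (hΞ : Ξ = Γ ++ α :: Θ)
    (hα : BinGen bin (· = ·) α Δ) : BinGen bin (· = ·) β (Γ ++ Δ ++ Θ) := by
  induction h generalizing Γ Θ with
  | term h =>
    subst h
    cases Γ with
    | nil =>
      obtain ⟨rfl, rfl⟩ : _ = α ∧ [] = Θ := by simpa using hΞ
      simpa using hα
    | cons c Γ => simp at hΞ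
  | @bin A B C x y h h₁ h₂ ih₁ ih₂ =>
    obtain ⟨z, rfl, rfl⟩ | ⟨z, rfl, hz⟩ := List.append_eq_append_iff.1 hΞ
    · simpa using BinGen.bin h h₁ (ih₂ rfl)
    · cases z with
      -- The position of `α` falls on the boundary between the two subtrees, so it is the first leaf
      -- of the right one.
      | nil =>
        obtain rfl : α :: Θ = y := hz
        simpa using BinGen.bin h h₁ (ih₂ (Γ := []) rfl)
      | cons c z =>
        obtain ⟨rfl, rfl⟩ : α = c ∧ Θ = z ++ y := by simpa using hz
        simpa using BinGen.bin h (ih₁ rfl) h₂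

theorem provable_iff_binGen (hR : R ⊆ {RuleName.slashL, RuleName.backslashL})
    {Γ : List (Tp Pr)} {α : Tp Pr} :
    Provable R Γ α ↔ BinGen (reduction R) (· = ·) α Γ := by
  constructor
  · intro h
    induction h with
    | ax α => exact .term rfl
    | cut _ _ ih₁ ih₂ => exact ih₁.subst (by simp) ih₂
    | backslashR h => simpa using hR h
    | slashR h => simpa using hR h
    | prodR h => simpa using hR h
    | prodL h => simpa using hR h
    | @backslashL Γ Δ Θ α β γ h _ _ ih₁ ih₂ =>
      have := ih₂.subst (Γ := Δ) (Θ := Θ) (α := β) (by simp)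
        (.bin (.inr ⟨h, rfl⟩) ih₁ (.term rfl))
      simpa using this
    | @slashL Γ Δ Θ α β γ h _ _ ih₁ ih₂ =>
      have := ih₂.subst (Γ := Δ) (Θ := Θ) (α := β) (by simp)
        (.bin (.inl ⟨h, rfl⟩) (.term rfl) ih₁)
      simpa using this
  · intro h
    induction h with
    | term h => exact h ▸ .ax _
    | @bin β X Y x y h _ _ ih₁ ih₂ =>
      obtain ⟨h, rfl⟩ | ⟨h, rfl⟩ := h
      · have := Provable.cut (Γ := []) (Θ := y)
          (by simpa using Provable.slashL (Δ := []) (Θ := []) h ih₂ (.ax β)) ih₁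
        simpa using this
      · have := Provable.cut (Γ := x) (Θ := [])
          (by simpa using Provable.backslashL (Δ := []) (Θ := []) h ih₁ (.ax β)) ih₂
        simpa using this

/-- Choosing types for the letters beforehand or at the leaves of the tree makes no difference. -/
theorem binGen_assign_iff {N : Type*} {V : Type*} {bin : N → N → N → Prop} {f : V → Set N}
    {α : N} {w : List V} :
    BinGen bin (fun α a => α ∈ f a) α w ↔
      ∃ Γ, List.Forall₂ (fun a α => α ∈ f a) w Γ ∧ BinGen bin (· = ·) α Γ := by
  constructor
  · intro h
    induction h with
    | @term A a h => exact ⟨[A], .cons h .nil, .term rfl⟩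
    | bin h _ _ ih₁ ih₂ =>
      obtain ⟨Γ, hΓ, h₁⟩ := ih₁
      obtain ⟨Δ, hΔ, h₂⟩ := ih₂
      exact ⟨Γ ++ Δ, List.rel_append hΓ hΔ, .bin h h₁ h₂⟩
  · rintro ⟨Γ, hΓ, h⟩
    induction h generalizing w with
    | term h =>
      obtain ⟨a, u, ha, hu, rfl⟩ := List.forall₂_cons_right_iff.1 hΓ
      obtain rfl := List.forall₂_nil_right_iff.1 hu
      subst h
      exact .term ha
    | @bin A B C x y h _ _ ih₁ ih₂ =>
      rw [← List.take_append_drop x.length w]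
      exact .bin h (ih₁ (List.forall₂_take_append _ _ _ hΓ))
        (ih₂ (List.forall₂_drop_append _ _ _ hΓ))

theorem mem_language_iff_binGen {V : Type v} {G : LambekGrammar V}
    (hR : R ⊆ {RuleName.slashL, RuleName.backslashL}) {w : List V} :
    w ∈ G.language R ↔
      BinGen (reduction R) (fun α a => α ∈ G.assign a) (Tp.prim G.start) w := by
  rw [binGen_assign_iff]
  constructor
  · rintro ⟨-, Γ, hΓ, h⟩
    exact ⟨Γ, hΓ, (provable_iff_binGen hR).1 h⟩
  · rintro ⟨Γ, hΓ, h⟩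
    refine ⟨?_, Γ, hΓ, (provable_iff_binGen hR).2 h⟩
    rintro rfl
    exact h.ne_nil (List.forall₂_nil_left_iff.1 hΓ)

end Calculus

/-! ### Lambek grammars with `/` and context-free languages -/

section ContextFree

variable {V : Type u}

/-- The subtypes of a type. -/
def subtypes {Pr : Type*} : Tp Pr → Set (Tp Pr)
  | .prim p => {.prim p}
  | .slash β α => {.slash β α} ∪ (subtypes β ∪ subtypes α)
  | .backslash α β => {.backslash α β} ∪ (subtypes α ∪ subtypes β)
  | .prod α β => {.prod α β} ∪ (subtypes α ∪ subtypes β)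

theorem finite_subtypes {Pr : Type*} (α : Tp Pr) : (subtypes α).Finite := by
  induction α with
  | prim p => exact Set.finite_singleton _
  | slash _ _ h₁ h₂ => exact (Set.finite_singleton _).union (h₁.union h₂)
  | backslash _ _ h₁ h₂ => exact (Set.finite_singleton _).union (h₁.union h₂)
  | prod _ _ h₁ h₂ => exact (Set.finite_singleton _).union (h₁.union h₂)

theorem self_mem_subtypes {Pr : Type*} (α : Tp Pr) : α ∈ subtypes α := by
  cases α <;> simp [subtypes]

theorem mem_subtypes_of_slash {Pr : Type*} {α β γ : Tp Pr} (h : .slash β γ ∈ subtypes α) :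
    β ∈ subtypes α := by
  induction α with
  | prim p => simp [subtypes] at h
  | slash _ _ h₁ h₂ =>
    obtain h | h | h := h
    · cases h
      exact .inr (.inl (self_mem_subtypes _))
    · exact .inr (.inl (h₁ h))
    · exact .inr (.inr (h₂ h))
  | backslash _ _ h₁ h₂ =>
    obtain h | h | h := h
    · cases h
    · exact .inr (.inl (h₁ h))
    · exact .inr (.inr (h₂ h))
  | prod _ _ h₁ h₂ =>
    obtain h | h | h := h
    · cases h
    · exact .inr (.inl (h₁ h))
    · exact .inr (.inr (h₂ h))

/-- Every type that generates a word is a subtype of an assigned one: leaves are assigned types, and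
`β` inherits this from its functor `β/α`. -/
theorem isBinGenerated_language [Finite V] (G : LambekGrammar V) :
    IsBinGenerated (G.language {RuleName.slashL}) := by
  refine .of_finite (F := ⋃ a, ⋃ α ∈ G.assign a, subtypes α)
    (Set.finite_iUnion fun a => (G.finite_assign a).biUnion fun α _ => finite_subtypes α)
    ?_ fun w => mem_language_iff_binGen (by simp)
  intro A w h
  induction h with
  | @term A a h => exact Set.mem_iUnion.2 ⟨a, Set.mem_biUnion h (self_mem_subtypes A)⟩
  | bin h _ _ ih₁ ih₂ =>
    obtain ⟨-, rfl⟩ | ⟨h, -⟩ := h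
    · simp only [Set.mem_iUnion] at ih₁ ⊢
      obtain ⟨a, α, hα, h⟩ := ih₁
      exact ⟨a, α, hα, mem_subtypes_of_slash h⟩
    · simp at h

/-! ### The left-corner transform -/

section LeftCorner

variable {N : Type v} (bin : N → N → N → Prop) (term : N → V → Prop)

/-- The primitive type of a nonterminal. -/
abbrev whole (A : N) : Tp (N ⊕ N × N) := .prim (.inl A)

/-- The primitive type of the words that complete a leading `X` to an `A`. -/
abbrev rest (A X : N) : Tp (N ⊕ N × N) := .prim (.inr (A, X))

/-- The type `β` can be started with any word generated from `C`. -/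
inductive Opens : Tp (N ⊕ N × N) → N → Prop
  | whole (C : N) : Opens (whole C) C
  | rest {A X C : N} : bin A X C → Opens (rest A X) C
  | step {A X Y C : N} : bin Y X C → Opens (.slash (rest A X) (rest A Y)) C

/-- The type assignment of the left-corner transform. -/
inductive LeftCornerType (a : V) : Tp (N ⊕ N × N) → Prop
  | whole {β : Tp (N ⊕ N × N)} {C : N} : Opens bin β C → term C a → LeftCornerType a β
  | corner {β : Tp (N ⊕ N × N)} {C Z : N} : Opens bin β C → term Z a →
      LeftCornerType a (.slash β (rest C Z))

variable {bin term}

/-- The residuated interpretation of types by languages. -/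
def meaning (bin : N → N → N → Prop) (term : N → V → Prop) : Tp (N ⊕ N × N) → Set (List V)
  | .prim (.inl A) => {w | BinGen bin term A w}
  | .prim (.inr (A, X)) => {w | ∀ x, BinGen bin term X x → BinGen bin term A (x ++ w)}
  | .slash β α => {w | ∀ x ∈ meaning bin term α, w ++ x ∈ meaning bin term β}
  | .backslash _ _ => ∅
  | .prod _ _ => ∅

theorem Opens.subset_meaning {β : Tp (N ⊕ N × N)} {C : N} (h : Opens bin β C) {w : List V}
    (hw : BinGen bin term C w) : w ∈ meaning bin term β := by
  cases h with
  | whole => exact hw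
  | rest h => exact fun x hx => .bin h hx hw
  | step h =>
    intro x hx y hy
    rw [← List.append_assoc]
    exact hx _ (.bin h hy hw)

theorem LeftCornerType.mem_meaning {a : V} {β : Tp (N ⊕ N × N)}
    (h : LeftCornerType bin term a β) : [a] ∈ meaning bin term β := by
  cases h with
  | whole h h' => exact h.subset_meaning (.term h')
  | corner h h' => exact fun x hx => h.subset_meaning (hx _ (.term h'))

/-- The second conjunct is the continuation form that makes the induction work: `w` is only the left
corner of a larger phrase `A`, which `y` completes. -/
theorem binGen_leftCorner {X : N} {w : List V} (h : BinGen bin term X w) :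
    (∀ β, Opens bin β X →
      BinGen (reduction {RuleName.slashL}) (fun β a => LeftCornerType bin term a β) β w) ∧
    ∀ β A y, Opens bin β A →
      BinGen (reduction {RuleName.slashL}) (fun β a => LeftCornerType bin term a β) (rest A X) y →
      BinGen (reduction {RuleName.slashL}) (fun β a => LeftCornerType bin term a β) β
        (w ++ y) := by
  have hs : ∀ β α : Tp (N ⊕ N × N), reduction {RuleName.slashL} β (.slash β α) α :=
    fun β α => .inl ⟨rfl, rfl⟩
  induction h with
  | term h =>
    exact ⟨fun β hβ => .term (.whole hβ h), fun β A y hβ hy => .bin (hs _ _)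
      (.term (.corner hβ h)) hy⟩
  | bin h _ _ ih₁ ih₂ =>
    refine ⟨fun β hβ => ih₁.2 _ _ _ hβ (ih₂.1 _ (.rest h)), fun β A y hβ hy => ?_⟩
    rw [List.append_assoc]
    -- For `X → BC`, the word of `C` receives type `rest A B / rest A X`; applied to `y` it yields
    -- the completion of the left corner `B` to `A`.
    exact ih₁.2 _ _ _ hβ (.bin (hs _ _) (ih₂.1 _ (.step h)) hy)

theorem binGen_leftCorner_iff {S : N} {w : List V} :
    BinGen (reduction {RuleName.slashL}) (fun β a => LeftCornerType bin term a β) (whole S) w ↔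
      BinGen bin term S w := by
  refine ⟨fun h => ?_, fun h => (binGen_leftCorner h).1 _ (.whole S)⟩
  -- Soundness: assigned types contain their letter in the residuated interpretation, and
  -- `/`-reduction is application of a residual.
  suffices key : ∀ β, BinGen (reduction {RuleName.slashL})
      (fun β a => LeftCornerType bin term a β) β w → w ∈ meaning bin term β from key _ h
  clear h
  intro β h
  induction h with
  | term h => exact h.mem_meaning
  | bin h _ _ ih₁ ih₂ =>
    obtain ⟨-, rfl⟩ | ⟨h, -⟩ := h
    · exact ih₁ _ ih₂
    · simp at h

theorem finite_setOf_opens [Finite N] : {β | ∃ C, Opens bin β C}.Finite := by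
  refine ((Set.finite_range (whole (N := N))).union
    ((Set.finite_range fun p : N × N => rest p.1 p.2).union
    (Set.finite_range fun p : N × N × N =>
      Tp.slash (rest p.1 p.2.1) (rest p.1 p.2.2)))).subset ?_
  rintro β ⟨C, h⟩
  cases h with
  | whole => exact .inl ⟨_, rfl⟩
  | rest => exact .inr (.inl ⟨(_, _), rfl⟩)
  | step => exact .inr (.inr ⟨(_, _, _), rfl⟩)

theorem finite_leftCornerType [Finite N] (a : V) :
    {β | LeftCornerType bin term a β}.Finite := by
  have hF := finite_setOf_opens (bin := bin)
  refine (hF.union ((hF.prod (Set.finite_univ (α := N × N))).image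
    fun p => Tp.slash p.1 (rest p.2.1 p.2.2))).subset ?_
  intro β h
  cases h with
  | whole h => exact .inl ⟨_, h⟩
  | corner h => exact .inr ⟨(_, _, _), ⟨⟨_, h⟩, trivial⟩, rfl⟩

theorem Opens.connectives_subset {β : Tp (N ⊕ N × N)} {C : N} (h : Opens bin β C) :
    β.connectives ⊆ {Connective.slash} := by
  cases h <;> simp [Tp.connectives]

end LeftCorner

theorem IsBinGenerated.exists_lambekGrammar {L : Language V} (h : IsBinGenerated L) :
    ∃ G : LambekGrammar V, (∀ a, G.assign a ⊆ TpOf G.Pr {Connective.slash}) ∧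
      G.language {RuleName.slashL} = L := by
  obtain ⟨N, _, S, bin, term, hL⟩ := h
  refine ⟨⟨N ⊕ N × N, inferInstance, .inl S, fun a => {β | LeftCornerType bin term a β},
    finite_leftCornerType⟩, ?_, ?_⟩
  · intro a β h
    cases h with
    | whole h => exact h.connectives_subset
    | corner h =>
      exact Set.union_subset subset_rfl
        (Set.union_subset h.connectives_subset (Set.empty_subset _))
  · ext w
    rw [mem_language_iff_binGen (by simp), hL]
    exact binGen_leftCorner_iff

end ContextFree

/-! ### Types of degree at most 1 and linear rules -/

section Linear

variable {V : Type u}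

/-- A reduction yields the numerator of an assigned functor, which is primitive. Hence a functor is
never the result of a reduction: it sits on a leaf, and each step adds one letter on one side. -/
theorem binGen_iff_linGen {Pr : Type*} {R : Set RuleName} {f : V → Set (Tp Pr)}
    (hslash : RuleName.slashL ∈ R)
    (hf : ∀ a, ∀ α ∈ f a, (∃ p, α = .prim p) ∨ (∃ p q, α = .slash (.prim p) (.prim q)) ∨
      (RuleName.backslashL ∈ R ∧ ∃ p q, α = .backslash (.prim q) (.prim p)))
    {p : Pr} {w : List V} :
    BinGen (reduction R) (fun α a => α ∈ f a) (.prim p) w ↔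
      LinGen (fun p a q => .slash (.prim p) (.prim q) ∈ f a)
        (fun p q a => .backslash (.prim q) (.prim p) ∈ f a) (fun p a => .prim p ∈ f a) p w := by
  constructor
  · suffices key : ∀ α, BinGen (reduction R) (fun α a => α ∈ f a) α w →
        (∃ a, w = [a] ∧ α ∈ f a) ∨ ∃ p, α = .prim p ∧
          LinGen (fun p a q => .slash (.prim p) (.prim q) ∈ f a)
            (fun p q a => .backslash (.prim q) (.prim p) ∈ f a)
            (fun p a => .prim p ∈ f a) p w by
      intro h
      obtain ⟨a, rfl, ha⟩ | ⟨q, hq, hw⟩ := key _ h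
      · exact .tm ha
      · cases hq
        exact hw
    intro α h
    have hp : ∀ {q : Pr} {w : List V}, ((∃ a, w = [a] ∧ .prim q ∈ f a) ∨
        ∃ p, Tp.prim q = .prim p ∧ LinGen (fun p a q => .slash (.prim p) (.prim q) ∈ f a)
          (fun p q a => .backslash (.prim q) (.prim p) ∈ f a)
          (fun p a => .prim p ∈ f a) p w) →
        LinGen (fun p a q => .slash (.prim p) (.prim q) ∈ f a)
          (fun p q a => .backslash (.prim q) (.prim p) ∈ f a)
          (fun p a => .prim p ∈ f a) q w := by
      rintro q w (⟨a, rfl, h⟩ | ⟨_, ⟨⟩, h⟩)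
      · exact .tm h
      · exact h
    induction h with
    | @term α a h => exact .inl ⟨a, rfl, h⟩
    | bin h _ _ ih₁ ih₂ =>
      obtain ⟨-, rfl⟩ | ⟨-, rfl⟩ := h
      · obtain ⟨a, rfl, ha⟩ | ⟨p, h, -⟩ := ih₁
        · obtain ⟨p, h⟩ | ⟨p, q, h⟩ | ⟨-, p, q, h⟩ := hf _ _ ha <;> cases h
          exact .inr ⟨p, rfl, .rt ha (hp ih₂)⟩
        · cases h
      · obtain ⟨a, rfl, ha⟩ | ⟨p, h, -⟩ := ih₂
        · obtain ⟨p, h⟩ | ⟨p, q, h⟩ | ⟨-, p, q, h⟩ := hf _ _ ha <;> cases h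
          exact .inr ⟨p, rfl, .lf ha (hp ih₁)⟩
        · cases h
  · intro h
    induction h with
    | tm h => exact .term h
    | rt h _ ih => exact .bin (x := [_]) (.inl ⟨hslash, rfl⟩) (.term h) ih
    | lf h _ ih =>
      refine .bin (.inr ⟨?_, rfl⟩) ih (.term h)
      obtain ⟨p, h⟩ | ⟨p, q, h⟩ | ⟨h', p, q, h⟩ := hf _ _ h <;> cases h
      exact h'

theorem exists_eq_of_mem_tpDeg_one {Pr : Type u} {C : Set Connective} {α : Tp Pr}
    (hC : Connective.prod ∉ C) (h : α ∈ TpDeg Pr 1 C) :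
    (∃ p, α = .prim p) ∨ (∃ p q, α = .slash (.prim p) (.prim q)) ∨
      (Connective.backslash ∈ C ∧ ∃ p q, α = .backslash (.prim q) (.prim p)) := by
  have hprim : ∀ β : Tp Pr, β.degree = 0 → ∃ p, β = .prim p := by
    rintro (p | _ | _ | _) h
    · exact ⟨p, rfl⟩
    all_goals simp [Tp.degree] at h
  obtain ⟨hd : α.degree ≤ 1, hc : α.connectives ⊆ C⟩ := h
  cases α with
  | prim p => exact .inl ⟨p, rfl⟩
  | slash β γ =>
    simp only [Tp.degree] at hd
    obtain ⟨p, rfl⟩ := hprim β (by omega)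
    obtain ⟨q, rfl⟩ := hprim γ (by omega)
    exact .inr (.inl ⟨p, q, rfl⟩)
  | backslash γ β =>
    simp only [Tp.degree] at hd
    obtain ⟨p, rfl⟩ := hprim β (by omega)
    obtain ⟨q, rfl⟩ := hprim γ (by omega)
    exact .inr (.inr ⟨hc (.inl rfl), p, q, rfl⟩)
  | prod => exact (hC (hc (.inl rfl))).elim

variable {R : Set RuleName} {C : Set Connective} {left : Prop}

/-- Types and rules correspond one to one, with the primitive types as nonterminals, so either kind
of grammar can be read as the other. -/
theorem exists_lambekGrammar_iff_isLinGenerated [Finite V] {L : Language V}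
    (hR : R ⊆ {RuleName.slashL, RuleName.backslashL}) (hslash : RuleName.slashL ∈ R)
    (hback : RuleName.backslashL ∈ R ↔ left) (hCprod : Connective.prod ∉ C)
    (hCslash : Connective.slash ∈ C) (hCback : Connective.backslash ∈ C ↔ left) :
    (∃ G : LambekGrammar V, (∀ a, G.assign a ⊆ TpDeg G.Pr 1 C) ∧ G.language R = L) ↔
      IsLinGenerated left L := by
  constructor
  · rintro ⟨G, hG, rfl⟩
    have := G.finite_Pr
    have hf := fun a (α : Tp G.Pr) (hα : α ∈ G.assign a) => exists_eq_of_mem_tpDeg_one hCprod (hG a hα)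
    refine ⟨G.Pr, this, G.start, _, _, _, ?_, fun w =>
      (mem_language_iff_binGen hR).trans (binGen_iff_linGen hslash ?_)⟩
    · intro p q a h
      obtain ⟨p, h⟩ | ⟨p, q, h⟩ | ⟨h', p, q, h⟩ := hf _ _ h <;> cases h
      exact hCback.1 h'
    · simpa only [hback, hCback] using hf
  · rintro ⟨N, _, S, rt, lf, tm, hlf, hL⟩
    let f (a : V) : Set (Tp N) := {α | (∃ p, tm p a ∧ α = .prim p) ∨
      (∃ p q, rt p a q ∧ α = .slash (.prim p) (.prim q)) ∨
      ∃ p q, lf p q a ∧ α = .backslash (.prim q) (.prim p)}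
    have hfin : ∀ a, (f a).Finite := by
      intro a
      refine ((Set.finite_range (Tp.prim (Pr := N))).union
        ((Set.finite_range fun p : N × N => Tp.slash (.prim p.1) (.prim p.2)).union
        (Set.finite_range fun p : N × N => Tp.backslash (.prim p.1) (.prim p.2)))).subset ?_
      rintro α (⟨p, -, rfl⟩ | ⟨p, q, -, rfl⟩ | ⟨p, q, -, rfl⟩)
      · exact .inl ⟨p, rfl⟩
      · exact .inr (.inl ⟨(p, q), rfl⟩)
      · exact .inr (.inr ⟨(q, p), rfl⟩)
    refine ⟨⟨N, inferInstance, S, f, hfin⟩, ?_, ?_⟩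
    · rintro a α (⟨p, -, rfl⟩ | ⟨p, q, -, rfl⟩ | ⟨p, q, h, rfl⟩)
      · simp [TpDeg, TpOf, Tp.degree, Tp.connectives]
      · simp [TpDeg, TpOf, Tp.degree, Tp.connectives, hCslash]
      · simp [TpDeg, TpOf, Tp.degree, Tp.connectives, hCback, hlf _ _ _ h]
    · ext w
      rw [mem_language_iff_binGen hR, hL]
      refine (binGen_iff_linGen hslash ?_).trans (iff_of_eq ?_)
      · rintro a α (⟨p, -, rfl⟩ | ⟨p, q, -, rfl⟩ | ⟨p, q, h, rfl⟩)
        · exact .inl ⟨p, rfl⟩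
        · exact .inr (.inl ⟨p, q, rfl⟩)
        · exact .inr (.inr ⟨hback.2 (hlf _ _ _ h), p, q, rfl⟩)
      · congr 1 <;> ext <;> simp [f]

end Linear

/-! ### Assembling the equivalences -/

theorem exists_isSimpleLinear_iff_isLinGenerated {V : Type u} [Finite V] {L : Language V}
    {left : Prop} :
    (∃ g : ContextFreeGrammar V, IsSimpleLinear left g ∧ g.language = L) ↔
      IsLinGenerated left L := by
  refine ⟨?_, IsLinGenerated.exists_isSimpleLinear⟩
  rintro ⟨g, hg, rfl⟩
  exact hg.isLinGenerated

theorem isLinearContextFree_iff_isLinGenerated {V : Type u} [Finite V] {L : Language V} :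
    IsLinearContextFree L ∧ [] ∉ L ↔ IsLinGenerated True L := by
  constructor
  · rintro ⟨⟨g, hg, rfl⟩, hL⟩
    exact IsLinearGrammar.isLinGenerated hg hL
  · intro h
    obtain ⟨g, hg, rfl⟩ := h.exists_isSimpleLinear
    exact ⟨⟨g, hg.isLinearGrammar, rfl⟩, h.nil_notMem⟩

theorem isRegular_iff_isLinGenerated {V : Type u} {L : Language V} :
    L.IsRegular ∧ [] ∉ L ↔ IsLinGenerated False L :=
  ⟨fun h => isLinGenerated_false_of_isRegular h.1 h.2, fun h => ⟨h.isRegular, h.nil_notMem⟩⟩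

end LambekFragments

theorem mainTheorem1 {V : Type*} [Finite V] (L : Language V) :
    -- `L(/ →)` with `Tp(/)` and context-free grammars
    List.TFAE
      [∃ G : LambekFragments.LambekGrammar V,
          (∀ a, G.assign a ⊆ LambekFragments.TpOf G.Pr {LambekFragments.Connective.slash}) ∧
          G.language {LambekFragments.RuleName.slashL} = L,
        ∃ g : ContextFreeGrammar V, LambekFragments.HasNoEmptyRule g ∧ g.language = L,
        L.IsContextFree ∧ [] ∉ L] ∧
    -- `L(/ →, \ →)` with `Tp_1(/, \)` and linear context-free grammars
    List.TFAE
      [∃ G : LambekFragments.LambekGrammar V,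
          (∀ a, G.assign a ⊆ LambekFragments.TpDeg G.Pr 1
            {LambekFragments.Connective.slash, LambekFragments.Connective.backslash}) ∧
          G.language {LambekFragments.RuleName.slashL, LambekFragments.RuleName.backslashL} = L,
        ∃ g : ContextFreeGrammar V, LambekFragments.IsLCFG g ∧ g.language = L,
        LambekFragments.IsLinearContextFree L ∧ [] ∉ L] ∧
    -- `L(/ →)` with `Tp_1(/)` and right-regular grammars
    List.TFAE
      [∃ G : LambekFragments.LambekGrammar V,
          (∀ a, G.assign a ⊆ LambekFragments.TpDeg G.Pr 1 {LambekFragments.Connective.slash}) ∧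
          G.language {LambekFragments.RuleName.slashL} = L,
        ∃ g : ContextFreeGrammar V, LambekFragments.IsREG g ∧ g.language = L,
        L.IsRegular ∧ [] ∉ L] := by
  refine ⟨?_, ?_, ?_⟩
  · tfae_have 1 → 2 := by
      rintro ⟨G, -, rfl⟩
      exact (LambekFragments.isBinGenerated_language G).exists_hasNoEmptyRule
    tfae_have 2 → 3 := by
      rintro ⟨g, hg, rfl⟩
      exact ⟨⟨g, rfl⟩, hg.nil_notMem⟩
    tfae_have 3 → 1 := fun h =>
      (LambekFragments.isBinGenerated_of_isContextFree h.1 h.2).exists_lambekGrammar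
    tfae_finish
  · tfae_have 1 ↔ 2 := by
      rw [LambekFragments.exists_lambekGrammar_iff_isLinGenerated (left := True) (by simp)
        (by simp) (by simp) (by simp) (by simp) (by simp),
        ← LambekFragments.exists_isSimpleLinear_iff_isLinGenerated]
      simp [LambekFragments.IsSimpleLinear, LambekFragments.IsLCFG]
    tfae_have 1 ↔ 3 := by
      rw [LambekFragments.exists_lambekGrammar_iff_isLinGenerated (left := True) (by simp)
        (by simp) (by simp) (by simp) (by simp) (by simp),
        ← LambekFragments.isLinearContextFree_iff_isLinGenerated]
    tfae_finish
  · tfae_have 1 ↔ 2 := by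
      rw [LambekFragments.exists_lambekGrammar_iff_isLinGenerated (left := False) (by simp)
        (by simp) (by simp) (by simp) (by simp) (by simp),
        ← LambekFragments.exists_isSimpleLinear_iff_isLinGenerated]
      simp [LambekFragments.IsSimpleLinear, LambekFragments.IsREG]
    tfae_have 1 ↔ 3 := by
      rw [LambekFragments.exists_lambekGrammar_iff_isLinGenerated (left := False) (by simp)
        (by simp) (by simp) (by simp) (by simp) (by simp),
        ← LambekFragments.isRegular_iff_isLinGenerated]
    tfae_finish
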